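/- Let $(\mathcal X,\mathcal A)$ be a measurable space and $(X,Y)$ a random pair with values in $\mathcal X\times\{-1,1\}$ and distribution $P$. For $\phi:\mathbb R\to\mathbb R$ and $f:\mathcal X\to\mathbb R$ put $A^\phi(f)=\mathbb E[\phi(Yf(X))]$, let $A^\phi_*$ be the minimal $\phi$-risk (the infimum of $A^\phi(f)$ over measurable real-valued $f$; as a constant it cancels from both sides of the inequalities below), and for i.i.d. copies $D_n=((X_1,Y_1),\dots,(X_n,Y_n))$ of $(X,Y)$ let $A^\phi_n(f)=\frac1n\sum_{i=1}^n\phi(Y_if(X_i))$. Write $A_0,A_0^*$ for $A^{\phi_0},A^{\phi_0}_*$ with $\phi_0(x)=\mathbf 1_{x\le 0}$, and let $f^*=\mathrm{sign}(2\eta-1)$ (with $\mathrm{sign}(0)=1$), $\eta(x)=\mathbb P(Y=1\mid X=x)$, be the Bayes classifier. For $\kappa\ge1$ and a constant $c\ge 2$ let $\mathcal P_\kappa$ be the set of all distributions $P$ satisfying the margin assumption MA($\kappa$): $$\mathbb E|f(X)-f^*(X)|\le c\,(A_0(f)-A_0^*)^{1/\kappa}\quad\text{for every measurable } f:\mathcal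 X\to\{-1,1\}.$$ A selector with values in a finite set $\mathcal F$ of classifiers is a statistic $\tilde f_n$, based on $D_n$, with values in $\mathcal F$. **Theorem.** There are absolute constants $C_3,C_4>0$ such that the following holds. Let $M\ge2$ be an integer, $\kappa\ge1$ and $c\ge2$ real numbers, $\mathcal X$ an infinite set whose points are separated by the measurable sets, and $\phi:\mathbb R\to\mathbb R$ a loss function with $a_\phi=\phi(-1)-\phi(1)>0$. There exists a set $\mathcal F$ of $M$ measurable classifiers with values in $\{-1,1\}$ such that, for every integer $n\ge1$ with $\sqrt{(\log M)/n}\le 1/2$: 1. For every selector $\tilde f_n$ with values in $\mathcal F$ there is a probability measure $P\in\mathcal P_\kappa$ such that, when $D_n$ is an i.i.d. sample from $P$, $$\mathbb E\big[A^\phi(\tilde f_n)-A^\phi_*\big]\ \ge\ \min_{f\in\mathcal F}\big(A^\phi(f)-A^\phi_*\big)+C_3\,a_\phi\Big(\frac{\log M}{n}\Big)^{\frac{\kappa}{2\kappa-1}}.$$ 2. Let $0\le C<\sqrt2/3$, let $\mathrm{pen}$ be a (possibly data-dependent) penalty on $\mathcal F$ with $|\mathrm{pen}(f)|\le C\sqrt{(\log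 M)/n}$ for all $f\in\mathcal F$, and let $\tilde f_n^{pERM}\in\mathrm{Arg\,min}_{f\in\mathcal F}\big(A^\phi_n(f)+\mathrm{pen}(f)\big)$ be a penalized empirical risk minimizer (a selector). If $1188\,\pi\, C^2M^{9C^2}\log M\le n$ (where $\pi=3.14\ldots$) and $\kappa>1$, then there is a probability measure $P\in\mathcal P_\kappa$ such that, when $D_n$ is an i.i.d. sample from $P$, $$\mathbb E\big[A^\phi(\tilde f_n^{pERM})-A^\phi_*\big]\ \ge\ \min_{f\in\mathcal F}\big(A^\phi(f)-A^\phi_*\big)+C_4\,a_\phi\sqrt{\frac{\log M}{n}}.$$ -/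

import Mathlib

open MeasureTheory

universe u

/-- The label set `{-1, 1}`, as a subtype of the reals. -/
abbrev Label : Type := {y : ℝ // y = -1 ∨ y = 1}

/-- The `φ`-risk `A^φ(f) = E[φ(Y f(X))]` of a real-valued classifier `f` when `(X, Y)` has
distribution `P`. -/
noncomputable def phiRisk {X : Type*} [MeasurableSpace X] (φ : ℝ → ℝ) (P : Measure (X × Label))
    (f : X → ℝ) : ℝ :=
  ∫ z, φ ((z.2 : ℝ) * f z.1) ∂P

/-- The minimal `φ`-risk `A^φ_*`: the infimum of the `φ`-risk over all measurable real-valued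
functions for which the risk is defined. For a loss whose risk is not bounded below, this is
Lean's default real number `0`; in a comparison of two excess risks `A^φ(f) - A^φ_*` this number
cancels, so that such a comparison remains one between the risks themselves. -/
noncomputable def minRisk {X : Type*} [MeasurableSpace X] (φ : ℝ → ℝ) (P : Measure (X × Label)) :
    ℝ :=
  sInf {a : ℝ | ∃ f : X → ℝ, Measurable f ∧
    Integrable (fun z : X × Label => φ ((z.2 : ℝ) * f z.1)) P ∧ a = phiRisk φ P f}

/-- The empirical `φ`-risk of `f` on the sample `D = ((X_1, Y_1), …, (X_n, Y_n))`. -/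
noncomputable def empRisk {X : Type*} {n : ℕ} (φ : ℝ → ℝ) (D : Fin n → X × Label)
    (f : X → ℝ) : ℝ :=
  (1 / (n : ℝ)) * ∑ i, φ (((D i).2 : ℝ) * f (D i).1)

open Classical in
/-- The classical (`0`-`1`) loss, the indicator of `x ≤ 0`. -/
noncomputable def zeroOneLoss (x : ℝ) : ℝ := if x ≤ 0 then 1 else 0

/-- The conditional probability function `η(x) = P(Y = 1 | X = x)`: the density of the measure
`A ↦ P(X ∈ A, Y = 1)` with respect to the distribution of `X`. -/
noncomputable def condProbOne {X : Type*} [MeasurableSpace X] (P : Measure (X × Label)) (x : X) :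
    ℝ :=
  (((P.restrict {z : X × Label | (z.2 : ℝ) = 1}).map Prod.fst).rnDeriv (P.map Prod.fst) x).toReal

open Classical in
/-- The Bayes classifier `f^* = sign(2η - 1)`, with the convention `sign 0 = 1`. -/
noncomputable def bayesClassifier {X : Type*} [MeasurableSpace X] (P : Measure (X × Label))
    (x : X) : ℝ :=
  if 0 ≤ 2 * condProbOne P x - 1 then 1 else -1

/-- `f` is a binary classifier: a measurable function with values in `{-1, 1}`. -/
def IsBinaryClassifier {X : Type*} [MeasurableSpace X] (f : X → ℝ) : Prop :=
  Measurable f ∧ ∀ x, f x = -1 ∨ f x = 1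

/-- The margin assumption MA(`κ`), with constant `c`, for the distribution `P` of `(X, Y)`. -/
def MarginAssumption {X : Type*} [MeasurableSpace X] (c κ : ℝ) (P : Measure (X × Label)) :
    Prop :=
  ∀ f : X → ℝ, IsBinaryClassifier f →
    ∫ z, |f z.1 - bayesClassifier P z.1| ∂P
      ≤ c * (phiRisk zeroOneLoss P f - minRisk zeroOneLoss P) ^ (1 / κ)

/-- `fhat` is a selector for `F` based on `n` observations: a statistic with values in `F`
(as `F` is finite, measurability means that the level sets are measurable). -/
def IsSelector {X : Type*} [MeasurableSpace X] {n : ℕ} (F : Finset (X → ℝ))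
    (fhat : (Fin n → X × Label) → X → ℝ) : Prop :=
  (∀ D, fhat D ∈ F) ∧ ∀ f ∈ F, MeasurableSet {D | fhat D = f}

/-- `fhat` is a penalized empirical risk minimizer over `F` with penalty `pen`: a selector which
minimizes `A^φ_n(f) + pen(f)` over `F`. The penalty may depend on the sample; a deterministic
penalty is one that does not depend on its first argument. -/
def IsPenalizedERM {X : Type*} [MeasurableSpace X] {n : ℕ} (φ : ℝ → ℝ) (F : Finset (X → ℝ))
    (pen : (Fin n → X × Label) → (X → ℝ) → ℝ) (fhat : (Fin n → X × Label) → X → ℝ) : Prop :=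
  IsSelector F fhat ∧
    ∀ D, ∀ f ∈ F, empRisk φ D (fhat D) + pen D (fhat D) ≤ empRisk φ D f + pen D f

/-- The expected excess risk `E[A^φ(fhat) - A^φ_*]` of a statistic `fhat` based on `n` independent
observations with distribution `P`. -/
noncomputable def expectedExcess {X : Type*} [MeasurableSpace X] {n : ℕ} (φ : ℝ → ℝ)
    (P : Measure (X × Label)) (fhat : (Fin n → X × Label) → X → ℝ) : ℝ :=
  ∫ D, (phiRisk φ P (fhat D) - minRisk φ P) ∂(Measure.pi fun _ : Fin n => P)

/-- The oracle excess risk `min_{f ∈ F} (A^φ(f) - A^φ_*)` of a (nonempty) finite set `F`. -/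
noncomputable def oracleExcess {X : Type*} [MeasurableSpace X] (φ : ℝ → ℝ)
    (P : Measure (X × Label)) (F : Finset (X → ℝ)) : ℝ :=
  ⨅ f : F, (phiRisk φ P (f : X → ℝ) - minRisk φ P)

/-! ### Signs on the cube and a second-moment bound -/

/-! Take the label equal to 1 almost surely. The Bayes classifier is then 1 almost everywhere, and
the distance to it is twice the 0-1 excess risk, a number in [0, 1]; so the margin assumption holds
for all κ ≥ 1 and c ≥ 2 at once, and the rate √(log M / n) serves both parts.

Embed the cube {-1,1}^M in the space and let the k-th classifier read the k-th coordinate. Under the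
j-th hypothesis the coordinates are independent signs, uniform except the j-th, of mean ε. The
φ-risk of a classifier is affine in its mean, so choosing any index but j costs exactly a_φ ε/2. A
selector with small regret would have to identify j.

It cannot: the success probabilities sum to at most ∑_ω max_j p_j(ω), which Cauchy–Schwarz and ∑_ω
p_j(ω)² = (1+ε²)^n / 2^(Mn) bound by √(M (1+ε²)^n) (`sq_sum_prod_biasedWeight_le`). With nε² = (log
M)/4 the average success is at most M^(-3/8) < 4/5. -/

/-- The sign of a Boolean: `true` is sent to `1`, `false` to `-1`. -/
noncomputable def boolSign (b : Bool) : ℝ := if b then 1 else -1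

lemma boolSign_eq (b : Bool) : boolSign b = -1 ∨ boolSign b = 1 := by
  cases b <;> simp [boolSign]

lemma boolSign_mul_self (b : Bool) : boolSign b * boolSign b = 1 := by
  cases b <;> simp [boolSign]

lemma boolSign_not (b : Bool) : boolSign (!b) = -boolSign b := by
  cases b <;> simp [boolSign]

section Cube

variable {M : ℕ}

lemma involutive_update_not (j : Fin M) :
    Function.Involutive fun s : Fin M → Bool => Function.update s j (!s j) := by
  intro s
  simp

/-- Flipping the `j`-th coordinate is an involution that negates every term, so the sum equals its
own opposite. -/
lemma sum_boolSign_mul (j : Fin M) (g : (Fin M → Bool) → ℝ)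
    (hg : ∀ s b, g (Function.update s j b) = g s) :
    ∑ s : Fin M → Bool, boolSign (s j) * g s = 0 := by
  have h := Equiv.sum_comp (involutive_update_not j).toPerm
    fun s : Fin M → Bool => boolSign (s j) * g s
  simp only [Function.Involutive.coe_toPerm, Function.update_self, hg, boolSign_not, neg_mul,
    Finset.sum_neg_distrib] at h
  linarith

lemma sum_boolSign (j : Fin M) : ∑ s : Fin M → Bool, boolSign (s j) = 0 := by
  simpa using sum_boolSign_mul j (fun _ => 1) fun _ _ => rfl

lemma sum_boolSign_mul_boolSign (j k : Fin M) :
    ∑ s : Fin M → Bool, boolSign (s j) * boolSign (s k) = if j = k then 2 ^ M else 0 := by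
  split_ifs with h
  · subst h
    simp [boolSign_mul_self]
  · exact sum_boolSign_mul j (fun s => boolSign (s k)) fun s b => by
      rw [Function.update_of_ne (Ne.symm h)]

/-- The probability of the vertex `s` of the cube when the coordinates are independent random
signs, all of them uniform but the `j`-th one, whose mean is `ε`. -/
noncomputable def biasedWeight (ε : ℝ) (j : Fin M) (s : Fin M → Bool) : ℝ :=
  (1 + ε * boolSign (s j)) / 2 ^ M

lemma biasedWeight_nonneg {ε : ℝ} (h0 : 0 ≤ ε) (h1 : ε ≤ 1) (j : Fin M) (s : Fin M → Bool) :
    0 ≤ biasedWeight ε j s := by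
  unfold biasedWeight
  rcases boolSign_eq (s j) with h | h <;> rw [h] <;> apply div_nonneg _ (by positivity) <;> linarith

lemma sum_biasedWeight (ε : ℝ) (j : Fin M) : ∑ s, biasedWeight ε j s = 1 := by
  simp [biasedWeight, ← Finset.sum_div, Finset.sum_add_distrib, ← Finset.mul_sum, sum_boolSign]

lemma sum_biasedWeight_mul_boolSign (ε : ℝ) (j k : Fin M) :
    ∑ s, biasedWeight ε j s * boolSign (s k) = if j = k then ε else 0 := by
  have h : ∀ s : Fin M → Bool, biasedWeight ε j s * boolSign (s k) =
      (boolSign (s k) + ε * (boolSign (s j) * boolSign (s k))) / 2 ^ M := fun s => by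
    unfold biasedWeight; ring
  simp only [h, ← Finset.sum_div, Finset.sum_add_distrib, ← Finset.mul_sum, sum_boolSign,
    sum_boolSign_mul_boolSign]
  split_ifs <;> simp

lemma sum_biasedWeight_sq (ε : ℝ) (j : Fin M) :
    ∑ s, biasedWeight ε j s ^ 2 = (1 + ε ^ 2) / 2 ^ M := by
  have h : ∀ s : Fin M → Bool, biasedWeight ε j s ^ 2 =
      ((1 + ε ^ 2) + 2 * ε * boolSign (s j)) / (2 ^ M * 2 ^ M) := fun s => by
    have := boolSign_mul_self (s j)
    rw [biasedWeight, div_pow, ← sq]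
    congr 1
    linear_combination ε ^ 2 * this
  simp only [h, ← Finset.sum_div, Finset.sum_add_distrib, ← Finset.mul_sum, sum_boolSign]
  simp
  field_simp

/-- Cauchy–Schwarz over all 2^(Mn) samples, then the square for the chosen index is bounded by the
sum over all indices. This costs a factor `M` but removes the dependence on `ψ`. -/
lemma sq_sum_prod_biasedWeight_le (ε : ℝ) {n : ℕ} (ψ : (Fin n → Fin M → Bool) → Fin M) :
    (∑ ω, ∏ i, biasedWeight ε (ψ ω) (ω i)) ^ 2 ≤ M * (1 + ε ^ 2) ^ n := by
  calc (∑ ω, ∏ i, biasedWeight ε (ψ ω) (ω i)) ^ 2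
      ≤ (Finset.univ : Finset (Fin n → Fin M → Bool)).card
          * ∑ ω, (∏ i, biasedWeight ε (ψ ω) (ω i)) ^ 2 := sq_sum_le_card_mul_sum_sq
    _ ≤ (Finset.univ : Finset (Fin n → Fin M → Bool)).card
          * ∑ ω : Fin n → Fin M → Bool, ∑ j, (∏ i, biasedWeight ε j (ω i)) ^ 2 := by
        gcongr with ω
        exact Finset.single_le_sum (f := fun j => (∏ i, biasedWeight ε j (ω i)) ^ 2)
          (fun _ _ => sq_nonneg _) (Finset.mem_univ _)
    _ = M * (1 + ε ^ 2) ^ n := by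
        rw [Finset.sum_comm]
        simp only [← Finset.prod_pow]
        have h (j : Fin M) : ∑ ω : Fin n → Fin M → Bool, ∏ i, biasedWeight ε j (ω i) ^ 2 =
            ((1 + ε ^ 2) / 2 ^ M) ^ n := by
          rw [← sum_biasedWeight_sq ε j, Fintype.sum_pow]
        simp [h, div_pow]
        field_simp

/-- The distribution on the cube with weights `biasedWeight ε j`. -/
noncomputable def biasedMeasure (ε : ℝ) (j : Fin M) : Measure (Fin M → Bool) :=
  ∑ s, ENNReal.ofReal (biasedWeight ε j s) • Measure.dirac s

lemma biasedMeasure_real_singleton {ε : ℝ} (h0 : 0 ≤ ε) (h1 : ε ≤ 1) (j : Fin M)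
    (s : Fin M → Bool) : (biasedMeasure ε j).real {s} = biasedWeight ε j s := by
  have : biasedMeasure ε j {s} = ENNReal.ofReal (biasedWeight ε j s) := by
    simp [biasedMeasure, Measure.finsetSum_apply, Set.indicator_apply]
  rw [measureReal_def, this, ENNReal.toReal_ofReal (biasedWeight_nonneg h0 h1 j s)]

lemma isProbabilityMeasure_biasedMeasure {ε : ℝ} (h0 : 0 ≤ ε) (h1 : ε ≤ 1) (j : Fin M) :
    IsProbabilityMeasure (biasedMeasure ε j) := by
  constructor
  simp only [biasedMeasure, Measure.finsetSum_apply, Measure.smul_apply, measure_univ,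
    smul_eq_mul, mul_one]
  rw [← ENNReal.ofReal_sum_of_nonneg fun s _ => biasedWeight_nonneg h0 h1 j s,
    sum_biasedWeight, ENNReal.ofReal_one]

lemma integral_biasedMeasure {ε : ℝ} (h0 : 0 ≤ ε) (h1 : ε ≤ 1) (j : Fin M)
    (g : (Fin M → Bool) → ℝ) :
    ∫ s, g s ∂(biasedMeasure ε j) = ∑ s, biasedWeight ε j s * g s := by
  have := isProbabilityMeasure_biasedMeasure h0 h1 j
  rw [integral_fintype .of_finite]
  simp [biasedMeasure_real_singleton h0 h1]

lemma pi_biasedMeasure_real {ε : ℝ} (h0 : 0 ≤ ε) (h1 : ε ≤ 1) (j : Fin M) {n : ℕ}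
    (A : Finset (Fin n → Fin M → Bool)) :
    (Measure.pi fun _ : Fin n => biasedMeasure ε j).real A
      = ∑ ω ∈ A, ∏ i, biasedWeight ε j (ω i) := by
  have := isProbabilityMeasure_biasedMeasure h0 h1 j
  rw [← sum_measureReal_singleton]
  refine Finset.sum_congr rfl fun ω _ => ?_
  rw [measureReal_def, Measure.pi_singleton, ENNReal.toReal_prod]
  exact Finset.prod_congr rfl fun i _ => biasedMeasure_real_singleton h0 h1 j (ω i)

/-- No estimator of the index of the biased coordinate does well under all the `M` hypotheses. -/
lemma exists_pi_biasedMeasure_real_le (hM : 2 ≤ M) {n : ℕ} {ε : ℝ} (h0 : 0 ≤ ε) (h1 : ε ≤ 1)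
    (hε : n * ε ^ 2 ≤ Real.log M / 4) (ψ : (Fin n → Fin M → Bool) → Fin M) :
    ∃ j, (Measure.pi fun _ : Fin n => biasedMeasure ε j).real {ω | ψ ω = j} ≤ 4 / 5 := by
  by_contra! h
  have hM0 : (0 : ℝ) < M := by positivity
  have hM2 : (2 : ℝ) ≤ M := by exact_mod_cast hM
  -- Each sample counts only for the index that `ψ` assigns to it.
  have hsum : ∑ j, (Measure.pi fun _ : Fin n => biasedMeasure ε j).real {ω | ψ ω = j}
      = ∑ ω, ∏ i, biasedWeight ε (ψ ω) (ω i) := by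
    rw [← Finset.sum_fiberwise Finset.univ ψ]
    refine Finset.sum_congr rfl fun j _ => ?_
    have : {ω | ψ ω = j} = ((Finset.univ.filter fun ω => ψ ω = j : Finset _) : Set _) := by
      ext; simp
    rw [this, pi_biasedMeasure_real h0 h1]
    exact Finset.sum_congr rfl fun ω hω => by rw [(Finset.mem_filter.1 hω).2]
  have hlow : (M : ℝ) * (4 / 5) ≤ ∑ ω, ∏ i, biasedWeight ε (ψ ω) (ω i) := by
    rw [← hsum]
    simpa using Finset.card_nsmul_le_sum Finset.univ _ (4 / 5 : ℝ) fun j _ => (h j).le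
  -- That is, t = M^(1/4).
  set t := Real.exp (Real.log M / 4) with ht
  have ht0 : 0 < t := Real.exp_pos _
  have ht4 : t ^ 4 = M := by
    rw [ht, ← Real.exp_nat_mul]
    push_cast
    rw [mul_div_cancel₀ _ (by norm_num), Real.exp_log hM0]
  have hpow : (1 + ε ^ 2) ^ n ≤ t := by
    calc (1 + ε ^ 2) ^ n ≤ Real.exp (ε ^ 2) ^ n := by
          gcongr
          linarith [Real.add_one_le_exp (ε ^ 2)]
      _ = Real.exp (n * ε ^ 2) := (Real.exp_nat_mul _ _).symm
      _ ≤ t := Real.exp_le_exp.2 hε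
  have key : (M * (4 / 5)) ^ 2 ≤ M * t :=
    calc ((M : ℝ) * (4 / 5)) ^ 2 ≤ (∑ ω, ∏ i, biasedWeight ε (ψ ω) (ω i)) ^ 2 := by gcongr
      _ ≤ M * (1 + ε ^ 2) ^ n := sq_sum_prod_biasedWeight_le ε ψ
      _ ≤ M * t := by gcongr
  have key2 : t ^ 4 * (16 / 25) ≤ t := by
    rw [ht4]
    have : (M : ℝ) * (M * (16 / 25)) ≤ M * t := by linarith
    exact le_of_mul_le_mul_left this hM0
  have key3 : t ^ 3 ≤ 25 / 16 := by
    have : t * (t ^ 3 * (16 / 25)) ≤ t * 1 := by linarith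
    linarith [le_of_mul_le_mul_left this ht0]
  -- The contradiction: t^12 = M³ ≥ 8, whereas (25/16)^4 < 6.
  have h12 : (t ^ 3) ^ 4 = (M : ℝ) ^ 3 := by rw [← ht4]; ring
  have hup : (t ^ 3) ^ 4 ≤ (25 / 16) ^ 4 := by gcongr
  have hlo : (2 : ℝ) ^ 3 ≤ (M : ℝ) ^ 3 := by gcongr
  norm_num at hup hlo
  linarith

end Cube

/-! ### Distributions with deterministic labels -/

section Risk

variable {X : Type*} [MeasurableSpace X]

/-- On {-1, 1} every function φ agrees with an affine one, so only the mean of `f` matters. -/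
lemma phiRisk_eq_of_isBinaryClassifier (φ : ℝ → ℝ) (P : Measure (X × Label))
    [IsProbabilityMeasure P] (hP : ∀ᵐ z ∂P, (z.2 : ℝ) = 1) {f : X → ℝ}
    (hf : IsBinaryClassifier f) :
    phiRisk φ P f = (φ 1 + φ (-1)) / 2 - (φ (-1) - φ 1) / 2 * ∫ z, f z.1 ∂P := by
  have hint : Integrable (fun z : X × Label => f z.1) P := by
    refine .of_bound (hf.1.comp measurable_fst).aestronglyMeasurable 1 (.of_forall fun z => ?_)
    rcases hf.2 z.1 with h | h <;> simp [h]
  have : phiRisk φ P f = ∫ z, ((φ 1 + φ (-1)) / 2 - (φ (-1) - φ 1) / 2 * f z.1) ∂P := by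
    refine integral_congr_ae ?_
    filter_upwards [hP] with z hz
    rw [hz, one_mul]
    rcases hf.2 z.1 with h | h <;> rw [h] <;> ring
  rw [this, integral_sub (integrable_const _) (hint.const_mul _), integral_const_mul]
  simp

/-- Restricting to label 1 does not change `P`, so η is the density of the marginal with respect to
itself. -/
lemma bayesClassifier_ae_eq_one (P : Measure (X × Label)) [IsProbabilityMeasure P]
    (hP : ∀ᵐ z ∂P, (z.2 : ℝ) = 1) : ∀ᵐ z ∂P, bayesClassifier P z.1 = 1 := by
  have h : ∀ᵐ x ∂(P.map Prod.fst), condProbOne P x = 1 := by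
    have hrestrict : P.restrict {z : X × Label | (z.2 : ℝ) = 1} = P :=
      Measure.restrict_eq_self_of_ae_mem hP
    unfold condProbOne
    rw [hrestrict]
    filter_upwards [(P.map Prod.fst).rnDeriv_self] with x hx
    simp [hx]
  filter_upwards [ae_of_ae_map measurable_fst.aemeasurable h] with z hz
  norm_num [bayesClassifier, hz]

lemma minRisk_zeroOneLoss_eq_zero (P : Measure (X × Label))
    (hP : ∀ᵐ z ∂P, (z.2 : ℝ) = 1) : minRisk zeroOneLoss P = 0 := by
  have h0 : ∀ x, 0 ≤ zeroOneLoss x := fun x => by unfold zeroOneLoss; split_ifs <;> simp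
  have hae : (fun z : X × Label => zeroOneLoss ((z.2 : ℝ) * 1)) =ᵐ[P] 0 := by
    filter_upwards [hP] with z hz
    norm_num [hz, zeroOneLoss]
  refine IsLeast.csInf_eq ⟨⟨fun _ => 1, measurable_const, ?_, ?_⟩, ?_⟩
  · exact (integrable_zero _ _ _).congr hae.symm
  · rw [phiRisk, integral_congr_ae hae]
    simp
  · rintro a ⟨f, -, -, rfl⟩
    exact integral_nonneg fun z => h0 _

/-- Under noise-free labels, the margin assumption holds for every `κ ≥ 1`. -/
lemma marginAssumption_of_ae_label_eq_one {c κ : ℝ} (hc : 2 ≤ c) (hκ : 1 ≤ κ)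
    (P : Measure (X × Label)) [IsProbabilityMeasure P] (hP : ∀ᵐ z ∂P, (z.2 : ℝ) = 1) :
    MarginAssumption c κ P := by
  intro f hf
  have hint : Integrable (fun z : X × Label => f z.1) P := by
    refine .of_bound (hf.1.comp measurable_fst).aestronglyMeasurable 1 (.of_forall fun z => ?_)
    rcases hf.2 z.1 with h | h <;> simp [h]
  have hdist : ∫ z, |f z.1 - bayesClassifier P z.1| ∂P = 1 - ∫ z, f z.1 ∂P := by
    have : ∫ z, |f z.1 - bayesClassifier P z.1| ∂P = ∫ z, (1 - f z.1) ∂P := by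
      refine integral_congr_ae ?_
      filter_upwards [bayesClassifier_ae_eq_one P hP] with z hz
      rw [hz]
      rcases hf.2 z.1 with h | h <;> norm_num [h]
    rw [this, integral_sub (integrable_const _) hint]
    simp
  have hle : -1 ≤ ∫ z, f z.1 ∂P := by
    have := integral_mono (μ := P) (integrable_const (-1 : ℝ)) hint fun z => by
      rcases hf.2 z.1 with h | h <;> norm_num [h]
    simpa using this
  have hrisk : phiRisk zeroOneLoss P f - minRisk zeroOneLoss P = (1 - ∫ z, f z.1 ∂P) / 2 := by
    rw [minRisk_zeroOneLoss_eq_zero P hP, phiRisk_eq_of_isBinaryClassifier _ P hP hf]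
    norm_num [zeroOneLoss]
    ring
  have hnn : 0 ≤ 1 - ∫ z, f z.1 ∂P := hdist ▸ integral_nonneg fun z => abs_nonneg _
  rw [hdist, hrisk]
  set r := (1 - ∫ z, f z.1 ∂P) / 2 with hr
  have hr0 : 0 ≤ r := by positivity
  have hr1 : r ≤ 1 := by linarith
  have hpow : r ≤ r ^ (1 / κ) := by
    have hκ0 : (0 : ℝ) < κ := by linarith
    calc r = r ^ (1 : ℝ) := (Real.rpow_one r).symm
      _ ≤ r ^ (1 / κ) := Real.rpow_le_rpow_of_exponent_ge' hr0 hr1 (by positivity)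
          ((div_le_one hκ0).2 hκ)
  -- The factor 2 here is why `c` must be at least 2.
  calc 1 - ∫ z, f z.1 ∂P = 2 * r := by rw [hr]; ring
    _ ≤ c * r ^ (1 / κ) := by gcongr

/-- Singletons need not be measurable. Intersecting finitely many separating sets isolates each
point from the other points of the family, and a union over `G` finishes. -/
lemma exists_measurableSet_mem_iff [MeasurableSpace.SeparatesPoints X] {S : Type*} [Finite S]
    {x : S → X} (hx : Function.Injective x) (G : Set S) :
    ∃ U : Set X, MeasurableSet U ∧ ∀ s, x s ∈ U ↔ s ∈ G := by
  choose A hA hmem hnot using fun (s t : S) (h : s ≠ t) =>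
    MeasurableSpace.exists_measurableSet_of_ne (hx.ne h)
  refine ⟨⋃ s ∈ G, ⋂ t, ⋂ h : s ≠ t, A s t h, ?_, fun s => ⟨fun hs => ?_, fun hs => ?_⟩⟩
  · exact (Set.toFinite G).measurableSet_biUnion fun s _ =>
      .iInter fun t => .iInter fun h => hA s t h
  · simp only [Set.mem_iUnion, Set.mem_iInter] at hs
    obtain ⟨t, ht, hst⟩ := hs
    by_contra hsG
    have hne : t ≠ s := by rintro rfl; exact hsG ht
    exact hnot t s hne (hst s hne)
  · simp only [Set.mem_iUnion, Set.mem_iInter]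
    exact ⟨s, hs, fun t h => hmem s t h⟩

end Risk

/-! ### The classifiers and the lower bound -/

lemma exists_classifiers_on_cube (X : Type*) [MeasurableSpace X]
    [MeasurableSpace.SeparatesPoints X] [Infinite X] (M : ℕ) :
    ∃ (x : (Fin M → Bool) → X) (f : Fin M → X → ℝ),
      (∀ k, IsBinaryClassifier (f k)) ∧ (∀ k s, f k (x s) = boolSign (s k)) ∧
        Function.Injective f := by
  classical
  obtain ⟨e⟩ : Nonempty ((Fin M → Bool) ↪ X) := by
    obtain ⟨g⟩ : Nonempty (ℕ ↪ X) := ⟨Infinite.natEmbedding X⟩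
    exact ⟨((Fintype.equivFin (Fin M → Bool)).toEmbedding.trans Fin.valEmbedding).trans g⟩
  choose U hU hmem using fun k : Fin M =>
    exists_measurableSet_mem_iff e.injective {s : Fin M → Bool | s k = true}
  have hval : ∀ k s, (if e s ∈ U k then (1 : ℝ) else -1) = boolSign (s k) := fun k s => by
    simp only [hmem, Set.mem_ofPred_eq, boolSign]
  refine ⟨e, fun k z => if z ∈ U k then 1 else -1, fun k => ⟨?_, fun z => ?_⟩, hval, ?_⟩
  · exact Measurable.ite (hU k) measurable_const measurable_const
  · dsimp only
    split_ifs <;> simp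
  · intro j k hjk
    by_contra hne
    -- The vertex whose only positive coordinate is the `j`-th distinguishes the two classifiers.
    have h := congrFun hjk (e (Function.update (fun _ => false) j true))
    simp only [hval] at h
    rw [Function.update_self, Function.update_of_ne (Ne.symm hne)] at h
    norm_num [boolSign] at h

section LowerBound

variable {X : Type*} [MeasurableSpace X] {M : ℕ}

/-- The distribution of `(X, 1)` where `X` is the image under `x` of a random vertex of the cube
with distribution `biasedMeasure ε j`. -/
noncomputable def biasedLaw (x : (Fin M → Bool) → X) (ε : ℝ) (j : Fin M) :
    Measure (X × Label) :=
  (biasedMeasure ε j).map fun s => (x s, ⟨1, Or.inr rfl⟩)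

variable {x : (Fin M → Bool) → X} {f : Fin M → X → ℝ}

lemma measurable_labelled_point :
    Measurable fun s : Fin M → Bool => ((x s, ⟨1, Or.inr rfl⟩) : X × Label) :=
  measurable_of_finite _

lemma isProbabilityMeasure_biasedLaw {ε : ℝ} (h0 : 0 ≤ ε) (h1 : ε ≤ 1) (j : Fin M) :
    IsProbabilityMeasure (biasedLaw x ε j) :=
  have := isProbabilityMeasure_biasedMeasure h0 h1 j
  Measure.isProbabilityMeasure_map measurable_labelled_point.aemeasurable

lemma biasedLaw_ae_label_eq_one (ε : ℝ) (j : Fin M) :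
    ∀ᵐ z ∂(biasedLaw x ε j), (z.2 : ℝ) = 1 := by
  have hset : MeasurableSet {z : X × Label | (z.2 : ℝ) = 1} :=
    (measurable_subtype_coe.comp measurable_snd) (measurableSet_singleton (1 : ℝ))
  rw [biasedLaw, ae_map_iff measurable_labelled_point.aemeasurable hset]
  simp

lemma phiRisk_biasedLaw (hf : ∀ k, IsBinaryClassifier (f k))
    (hfx : ∀ k s, f k (x s) = boolSign (s k)) (φ : ℝ → ℝ) {ε : ℝ} (h0 : 0 ≤ ε) (h1 : ε ≤ 1)
    (j k : Fin M) :
    phiRisk φ (biasedLaw x ε j) (f k) =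
      (φ 1 + φ (-1)) / 2 - (φ (-1) - φ 1) / 2 * if j = k then ε else 0 := by
  have := isProbabilityMeasure_biasedLaw (x := x) h0 h1 j
  have hmeas : Measurable fun z : X × Label => f k z.1 := (hf k).1.comp measurable_fst
  rw [phiRisk_eq_of_isBinaryClassifier φ _ (biasedLaw_ae_label_eq_one ε j) (hf k), biasedLaw,
    integral_map measurable_labelled_point.aemeasurable hmeas.aestronglyMeasurable]
  simp only [hfx]
  rw [integral_biasedMeasure h0 h1, sum_biasedWeight_mul_boolSign]

/-- All wrong choices have the same risk, so the regret is the cost of an error times its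
probability. -/
lemma expectedExcess_biasedLaw (hf : ∀ k, IsBinaryClassifier (f k))
    (hfx : ∀ k s, f k (x s) = boolSign (s k)) (φ : ℝ → ℝ) {ε : ℝ} (h0 : 0 ≤ ε) (h1 : ε ≤ 1)
    (j : Fin M) {n : ℕ} {fhat : (Fin n → X × Label) → X → ℝ} (hrange : ∀ D, ∃ k, fhat D = f k)
    (hmeas : MeasurableSet {D | fhat D = f j}) :
    expectedExcess φ (biasedLaw x ε j) fhat =
      phiRisk φ (biasedLaw x ε j) (f j) - minRisk φ (biasedLaw x ε j)
        + (φ (-1) - φ 1) / 2 * ε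
          * (1 - (Measure.pi fun _ : Fin n => biasedLaw x ε j).real {D | fhat D = f j}) := by
  classical
  have := isProbabilityMeasure_biasedLaw (x := x) h0 h1 j
  set P := biasedLaw x ε j with hP
  have hpt : ∀ D, phiRisk φ P (fhat D) - minRisk φ P =
      (phiRisk φ P (f j) - minRisk φ P + (φ (-1) - φ 1) / 2 * ε)
        - (φ (-1) - φ 1) / 2 * ε * {D | fhat D = f j}.indicator 1 D := by
    intro D
    by_cases hD : fhat D = f j
    · simp [hD]
    · obtain ⟨k, hk⟩ := hrange D
      have hjk : j ≠ k := by rintro rfl; exact hD hk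
      have hmem : D ∉ {D | fhat D = f j} := hD
      rw [Set.indicator_of_notMem hmem, hk, hP, phiRisk_biasedLaw hf hfx φ h0 h1,
        phiRisk_biasedLaw hf hfx φ h0 h1, if_neg hjk, if_pos rfl]
      ring
  have hint : Integrable ({D | fhat D = f j}.indicator (1 : (Fin n → X × Label) → ℝ))
      (Measure.pi fun _ : Fin n => P) := (integrable_const (1 : ℝ)).indicator hmeas
  rw [expectedExcess]
  simp only [hpt]
  rw [integral_sub (integrable_const _) (hint.const_mul _), integral_const_mul,
    integral_indicator_one hmeas]
  simp
  ring

lemma pi_biasedLaw_real {ε : ℝ} (h0 : 0 ≤ ε) (h1 : ε ≤ 1) (j : Fin M) {n : ℕ}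
    {A : Set (Fin n → X × Label)} (hA : MeasurableSet A) :
    (Measure.pi fun _ : Fin n => biasedLaw x ε j).real A =
      (Measure.pi fun _ : Fin n => biasedMeasure ε j).real
        {ω | (fun i => (x (ω i), ⟨1, Or.inr rfl⟩)) ∈ A} := by
  have := isProbabilityMeasure_biasedMeasure h0 h1 j
  have := isProbabilityMeasure_biasedLaw (x := x) h0 h1 j
  have hpi : (Measure.pi fun _ : Fin n => biasedLaw x ε j) =
      (Measure.pi fun _ : Fin n => biasedMeasure ε j).map
        fun ω i => ((x (ω i), ⟨1, Or.inr rfl⟩) : X × Label) :=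
    (Measure.pi_map_pi (hμ := fun _ => by change SigmaFinite (biasedLaw x ε j); infer_instance)
      fun _ => measurable_labelled_point.aemeasurable).symm
  rw [hpi, map_measureReal_apply (measurable_of_finite _) hA]
  rfl

lemma oracleExcess_le (φ : ℝ → ℝ) (P : Measure (X × Label)) (F : Finset (X → ℝ)) {g : X → ℝ}
    (hg : g ∈ F) : oracleExcess φ P F ≤ phiRisk φ P g - minRisk φ P :=
  ciInf_le (f := fun h : F => phiRisk φ P (h : X → ℝ) - minRisk φ P)
    (Set.finite_range _).bddBelow ⟨g, hg⟩

/-- Every selector over a family of `M` classifiers which shatter a cube misses the oracle, for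
some noise-free distribution, by a multiple of `√(log M / n)`. -/
lemma exists_expectedExcess_ge (hM : 2 ≤ M) (hf : ∀ k, IsBinaryClassifier (f k))
    (hfx : ∀ k s, f k (x s) = boolSign (s k)) (hinj : Function.Injective f) {φ : ℝ → ℝ}
    (hφ : 0 < φ (-1) - φ 1) {F : Finset (X → ℝ)} (hF : ∀ g, g ∈ F ↔ ∃ k, f k = g) {n : ℕ}
    (hn : 1 ≤ n) (hle : Real.sqrt (Real.log M / n) ≤ 1 / 2)
    {fhat : (Fin n → X × Label) → X → ℝ} (hsel : IsSelector F fhat) :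
    ∃ P : Measure (X × Label), IsProbabilityMeasure P ∧ (∀ᵐ z ∂P, (z.2 : ℝ) = 1) ∧
      oracleExcess φ P F + 1 / 20 * (φ (-1) - φ 1) * Real.sqrt (Real.log M / n)
        ≤ expectedExcess φ P fhat := by
  have hn0 : (0 : ℝ) < n := by exact_mod_cast hn
  have hlog : 0 ≤ Real.log M := Real.log_natCast_nonneg M
  set r := Real.sqrt (Real.log M / n) with hr
  have hr0 : 0 ≤ r := Real.sqrt_nonneg _
  -- The bias is ε = r/2, so that nε² = (log M)/4.
  have h0 : 0 ≤ r / 2 := by positivity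
  have h1 : r / 2 ≤ 1 := by linarith
  have hε : n * (r / 2) ^ 2 ≤ Real.log M / 4 := by
    rw [div_pow, hr, Real.sq_sqrt (by positivity)]
    field_simp
    norm_num
  choose ψ hψ using fun D => (hF _).1 (hsel.1 D)
  obtain ⟨j, hj⟩ := exists_pi_biasedMeasure_real_le hM h0 h1 hε
    fun ω => ψ fun i => (x (ω i), ⟨1, Or.inr rfl⟩)
  have hmeas : MeasurableSet {D | fhat D = f j} := hsel.2 _ ((hF _).2 ⟨j, rfl⟩)
  refine ⟨biasedLaw x (r / 2) j, isProbabilityMeasure_biasedLaw h0 h1 j,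
    biasedLaw_ae_label_eq_one _ j, ?_⟩
  have hprob : (Measure.pi fun _ : Fin n => biasedLaw x (r / 2) j).real {D | fhat D = f j}
      ≤ 4 / 5 := by
    rw [pi_biasedLaw_real h0 h1 j hmeas]
    convert hj using 3 with ω
    simp only [Set.mem_ofPred_eq, ← hψ, hinj.eq_iff]
  rw [expectedExcess_biasedLaw hf hfx φ h0 h1 j (fun D => ⟨ψ D, (hψ D).symm⟩) hmeas]
  have horacle := oracleExcess_le φ (biasedLaw x (r / 2) j) F ((hF _).2 ⟨j, rfl⟩)
  -- The constant: 1/2 from the risk, 1/2 from ε = r/2, and 1/5 from the error probability give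
  -- 1/20.
  have hmul : (φ (-1) - φ 1) / 2 * (r / 2) * (1 / 5) ≤ (φ (-1) - φ 1) / 2 * (r / 2)
      * (1 - (Measure.pi fun _ : Fin n => biasedLaw x (r / 2) j).real {D | fhat D = f j}) := by
    gcongr
    linarith
  linarith

end LowerBound

/-- The exponent κ/(2κ-1) is at least 1/2 and the base at most 1, so the square-root rate dominates.
-/
lemma rpow_margin_exponent_le_sqrt {u κ : ℝ} (h0 : 0 ≤ u) (h1 : u ≤ 1) (hκ : 1 ≤ κ) :
    u ^ (κ / (2 * κ - 1)) ≤ Real.sqrt u := by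
  rw [Real.sqrt_eq_rpow]
  refine Real.rpow_le_rpow_of_exponent_ge' h0 h1 (by norm_num) ?_
  rw [div_le_div_iff₀ (by norm_num) (by linarith)]
  linarith

theorem theorem3 :
    ∃ C₃ C₄ : ℝ, 0 < C₃ ∧ 0 < C₄ ∧
    ∀ (X : Type u) [MeasurableSpace X] [MeasurableSpace.SeparatesPoints X] [Infinite X]
      (M : ℕ) (_ : 2 ≤ M) (κ : ℝ) (_ : 1 ≤ κ) (c : ℝ) (_ : 2 ≤ c)
      (φ : ℝ → ℝ) (_ : 0 < φ (-1) - φ 1),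
    ∃ F : Finset (X → ℝ), F.card = M ∧ (∀ f ∈ F, IsBinaryClassifier f) ∧
      ∀ (n : ℕ) (_ : 1 ≤ n) (_ : Real.sqrt (Real.log M / n) ≤ 1 / 2),
      -- lower bound for every selector
      (∀ fhat : (Fin n → X × Label) → X → ℝ, IsSelector F fhat →
        ∃ P : Measure (X × Label), IsProbabilityMeasure P ∧ MarginAssumption c κ P ∧
          expectedExcess φ P fhat ≥ oracleExcess φ P F
            + C₃ * (φ (-1) - φ 1) * (Real.log M / n) ^ (κ / (2 * κ - 1))) ∧
      -- lower bound for every penalized empirical risk minimizer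
      (∀ (C : ℝ) (pen : (Fin n → X × Label) → (X → ℝ) → ℝ)
        (fhat : (Fin n → X × Label) → X → ℝ),
        0 ≤ C → C < Real.sqrt 2 / 3 →
        (∀ D, ∀ f ∈ F, |pen D f| ≤ C * Real.sqrt (Real.log M / n)) →
        1188 * Real.pi * C ^ 2 * (M : ℝ) ^ (9 * C ^ 2) * Real.log M ≤ n →
        1 < κ →
        IsPenalizedERM φ F pen fhat →
        ∃ P : Measure (X × Label), IsProbabilityMeasure P ∧ MarginAssumption c κ P ∧
          expectedExcess φ P fhat ≥ oracleExcess φ P F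
            + C₄ * (φ (-1) - φ 1) * Real.sqrt (Real.log M / n)) := by
  classical
  refine ⟨1 / 20, 1 / 20, by norm_num, by norm_num, ?_⟩
  intro X _ _ _ M hM κ hκ c hc φ hφ
  obtain ⟨x, f, hf, hfx, hinj⟩ := exists_classifiers_on_cube X M
  have hF : ∀ g, g ∈ Finset.univ.image f ↔ ∃ k, f k = g := fun g => by simp
  refine ⟨Finset.univ.image f, ?_, fun g hg => ?_, fun n hn hle => ⟨fun fhat hsel => ?_,
    fun C pen fhat _ _ _ _ _ hERM => ?_⟩⟩
  · rw [Finset.card_image_of_injective _ hinj, Finset.card_fin]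
  · obtain ⟨k, rfl⟩ := (hF g).1 hg
    exact hf k
  · obtain ⟨P, hprob, hlabel, hbound⟩ := exists_expectedExcess_ge hM hf hfx hinj hφ hF hn hle hsel
    refine ⟨P, hprob, marginAssumption_of_ae_label_eq_one hc hκ P hlabel, le_trans ?_ hbound⟩
    have hu : 0 ≤ Real.log M / n := div_nonneg (Real.log_natCast_nonneg M) (Nat.cast_nonneg n)
    have hu1 : Real.log M / n ≤ 1 := Real.sqrt_le_one.1 (hle.trans (by norm_num))
    have := rpow_margin_exponent_le_sqrt hu hu1 hκ
    gcongr
  · obtain ⟨P, hprob, hlabel, hbound⟩ :=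
      exists_expectedExcess_ge hM hf hfx hinj hφ hF hn hle hERM.1
    exact ⟨P, hprob, marginAssumption_of_ae_label_eq_one hc hκ P hlabel, hbound⟩
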